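/- **Lemma.** Let $d\in\mathbb{N}$ and equip $\mathbb{R}^d$ with the Euclidean norm $\|\cdot\|$. For $S\subseteq\mathbb{R}^d$ and $g\colon S\to\mathbb{R}^d$ put $$\operatorname{Lip}(g):=\sup\left\{\frac{\|g(y)-g(x)\|}{\|y-x\|}\colon x,y\in S,\ x\neq y\right\}\in[0,\infty]\qquad(\sup\emptyset:=0),$$ and for $C\geq 1$ call $g$ *$C$-bilipschitz* if $g$ is injective and $\max\{\operatorname{Lip}(g),\operatorname{Lip}(g^{-1})\}\leq C$, where $g^{-1}\colon g(S)\to S$ is the inverse of $g$. Write $\overline{A}$ and $\partial A$ for the closure and the boundary of $A$ in $\mathbb{R}^d$. Let $I$ be a set and let $(A_i)_{i\in I}$ be a collection of pairwise disjoint open subsets of $\mathbb{R}^d$ such that $\mathbb{R}^d=\bigcup_{i\in I}\overline{A_i}$. Let $C\geq 1$ and let $f\colon\mathbb{R}^d\to\mathbb{R}^d$ be a mapping such that the restriction $f|_{\bigcup_{i\in I}\partial A_i}$ is $C$-bilipschitz and, for every $i\in I$, the restriction $f|_{\overline{A_i}}$ is $C$-bilipschitz and $f(\overline{A_i})=\overline{A_i}$.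 Then $f$ is $C$-bilipschitz. -/

import Mathlib

open scoped ENNReal

/-- The Lipschitz constant `Lip(f) = sup {|f y - f x| / |y - x| : x ≠ y}`, with values in `[0, ∞]`;
the supremum over the empty set is `0`. -/
noncomputable def lipConst {X Y : Type*} [MetricSpace X] [MetricSpace Y] (f : X → Y) : ℝ≥0∞ :=
  ⨆ (x : X) (y : X) (_ : x ≠ y), edist (f y) (f x) / edist y x

/-- For an injective map `f`, the constant `bilip(f) = max {Lip(f), Lip(f⁻¹)}`, where `f⁻¹` is the
inverse map defined on the image of `f`. -/
noncomputable def bilipConst {X Y : Type*} [MetricSpace X] [MetricSpace Y] (f : X → Y)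
    (hf : Function.Injective f) : ℝ≥0∞ :=
  max (lipConst f) (lipConst (Equiv.ofInjective f hf).symm)

/-- `f` is `L`-bilipschitz: it is injective and `bilip(f) ≤ L`. -/
def IsBilipschitz {X Y : Type*} [MetricSpace X] [MetricSpace Y] (L : ℝ) (f : X → Y) : Prop :=
  ∃ hf : Function.Injective f, bilipConst f hf ≤ ENNReal.ofReal L

open Set Metric MeasureTheory Measure Module
open scoped NNReal Topology

/-! Upper bound: a segment from a point of one cell closure to a point of another leaves the first
cell at a frontier point and enters the second for good at another. The three bounds (cell,
frontiers, cell) add up along the segment with the same constant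
(`dist_le_of_forall_closure_of_frontier`).

Lower bound: apply the same lemma to the inverse of `f`, with cells `f '' A i`. These replace the `A
i` because `f` need not preserve `A i` or its frontier, only the closure. They are open by
invariance of domain (`IsOpen.image_of_bilipschitzOn`), which also yields their disjointness and the
injectivity of `f`.

Invariance of domain is proved analytically. If `g` is Lipschitz and vanishes off a ball, the
Jacobian of `id + t • g` integrates over the ball to its volume: for small `t` by change of
variables, and at `t = 1` because the Jacobian is polynomial in `t`. A map into a sphere has zero
Jacobian, so `id + g` cannot be zero-free. Volume is top-dimensional Hausdorff measure, for which
Lipschitz images of null sets are clearly null. -/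

theorem lipConst_le_ofReal_iff {X Y : Type*} [MetricSpace X] [MetricSpace Y] {f : X → Y} {L : ℝ}
    (hL : 0 ≤ L) : lipConst f ≤ ENNReal.ofReal L ↔ ∀ x y, dist (f x) (f y) ≤ L * dist x y := by
  simp only [lipConst, iSup_le_iff]
  have key : ∀ x y, x ≠ y → (edist (f y) (f x) / edist y x ≤ ENNReal.ofReal L ↔
      dist (f x) (f y) ≤ L * dist x y) := by
    intro x y hxy
    rw [ENNReal.div_le_iff (by simpa [edist_eq_zero] using hxy.symm) (edist_ne_top _ _),
      edist_dist, edist_dist, ← ENNReal.ofReal_mul hL,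
      ENNReal.ofReal_le_ofReal_iff (by positivity), dist_comm (f y), dist_comm y]
  refine forall₂_congr fun x y => ⟨fun h => ?_, fun h hxy => (key x y hxy).2 h⟩
  rcases eq_or_ne x y with rfl | hxy
  · simp
  · exact (key x y hxy).1 (h hxy)

theorem isBilipschitz_iff {X Y : Type*} [MetricSpace X] [MetricSpace Y] {f : X → Y} {L : ℝ}
    (hL : 0 ≤ L) : IsBilipschitz L f ↔
      (∀ x y, dist (f x) (f y) ≤ L * dist x y) ∧ ∀ x y, dist x y ≤ L * dist (f x) (f y) := by
  constructor
  · rintro ⟨hf, h⟩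
    rw [bilipConst, max_le_iff, lipConst_le_ofReal_iff hL, lipConst_le_ofReal_iff hL] at h
    refine ⟨h.1, fun x y => ?_⟩
    have := h.2 (Equiv.ofInjective f hf x) (Equiv.ofInjective f hf y)
    simpa [Subtype.dist_eq] using this
  · rintro ⟨h1, h2⟩
    have hf : Function.Injective f := fun x y hxy => by
      have := h2 x y
      rw [hxy, dist_self, mul_zero] at this
      exact dist_le_zero.1 this
    refine ⟨hf, ?_⟩
    rw [bilipConst, max_le_iff, lipConst_le_ofReal_iff hL, lipConst_le_ofReal_iff hL]
    refine ⟨h1, fun x y => ?_⟩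
    have := h2 ((Equiv.ofInjective f hf).symm x) ((Equiv.ofInjective f hf).symm y)
    rwa [Equiv.apply_ofInjective_symm hf, Equiv.apply_ofInjective_symm hf] at this

theorem isBilipschitz_domRestrict_iff {X Y : Type*} [MetricSpace X] [MetricSpace Y] {f : X → Y}
    {s : Set X} {L : ℝ} (hL : 0 ≤ L) : IsBilipschitz L (s.domRestrict f) ↔
      (∀ x ∈ s, ∀ y ∈ s, dist (f x) (f y) ≤ L * dist x y) ∧
        ∀ x ∈ s, ∀ y ∈ s, dist x y ≤ L * dist (f x) (f y) := by
  simp [isBilipschitz_iff hL, Subtype.dist_eq]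

/-! ### Gluing Lipschitz bounds along segments. -/

section Gluing
variable {E : Type*} [NormedAddCommGroup E] [NormedSpace ℝ E]

/-- A segment that starts in the closure of an open set and ends outside the set stays in the set
until it meets the frontier. -/
theorem IsOpen.exists_lineMap_mem_frontier {A : Set E} (hA : IsOpen A) {x y : E}
    (hx : x ∈ closure A) (hy : y ∉ A) :
    ∃ t ∈ Icc (0 : ℝ) 1, AffineMap.lineMap x y t ∈ frontier A ∧
      ∀ s ∈ Ico (0 : ℝ) t, AffineMap.lineMap x y s ∈ A := by
  let p : ℝ → E := AffineMap.lineMap x y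
  have hp : Continuous p := AffineMap.lineMap_continuous
  have hcpt : IsCompact (Icc (0 : ℝ) 1 ∩ p ⁻¹' Aᶜ) :=
    isCompact_Icc.inter_right (hA.isClosed_compl.preimage hp)
  obtain ⟨t, ⟨ht, htA⟩, hmin⟩ := hcpt.exists_isLeast ⟨1, by simp, by simpa [p] using hy⟩
  have hlt : ∀ s ∈ Ico (0 : ℝ) t, p s ∈ A := fun s hs => by
    by_contra h
    exact absurd (hmin ⟨⟨hs.1, hs.2.le.trans ht.2⟩, h⟩) (not_le.2 hs.2)
  refine ⟨t, ht, ?_, hlt⟩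
  rw [hA.frontier_eq]
  refine ⟨?_, htA⟩
  rcases ht.1.eq_or_lt with h | h
  · simpa [← h] using hx
  · have : t ∈ closure (Ico 0 t) := by
      rw [closure_Ico h.ne]; exact ⟨h.le, le_rfl⟩
    exact closure_mono (image_subset_iff.2 hlt) (image_closure_subset_closure_image hp ⟨t, this, rfl⟩)

/-- Lipschitz bounds on the closures of disjoint open sets covering the space and on the union of
their frontiers give a global Lipschitz bound. -/
theorem dist_le_of_forall_closure_of_frontier {ι X : Type*} [PseudoMetricSpace X] {A : ι → Set E}
    (hopen : ∀ i, IsOpen (A i)) (hdisj : ∀ i j, i ≠ j → Disjoint (A i) (A j))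
    (hcover : ⋃ i, closure (A i) = univ) {C : ℝ} {f : E → X}
    (hfr : ∀ x ∈ ⋃ i, frontier (A i), ∀ y ∈ ⋃ i, frontier (A i), dist (f x) (f y) ≤ C * dist x y)
    (hcl : ∀ i, ∀ x ∈ closure (A i), ∀ y ∈ closure (A i), dist (f x) (f y) ≤ C * dist x y)
    (x y : E) : dist (f x) (f y) ≤ C * dist x y := by
  obtain ⟨i, hi⟩ := mem_iUnion.1 (hcover ▸ mem_univ x)
  obtain ⟨j, hj⟩ := mem_iUnion.1 (hcover ▸ mem_univ y)
  rcases eq_or_ne i j with rfl | hij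
  · exact hcl i x hi y hj
  have hyA : y ∉ A i := ((hdisj i j hij).symm.closure_left (hopen i)).notMem_of_mem_left hj
  have hxA : x ∉ A j := ((hdisj i j hij).closure_left (hopen j)).notMem_of_mem_left hi
  obtain ⟨t, ht, htf, htA⟩ := (hopen i).exists_lineMap_mem_frontier hi hyA
  obtain ⟨u, hu, huf, huA⟩ := (hopen j).exists_lineMap_mem_frontier hj hxA
  have hrev : ∀ s : ℝ, AffineMap.lineMap y x s = AffineMap.lineMap x y (1 - s) := fun s => by
    rw [AffineMap.lineMap_apply_one_sub]
  -- Otherwise the midpoint of the parameters `1 - u` and `t` gives a point in both cells.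
  have hle : t ≤ 1 - u := by
    by_contra! h
    have h1 := htA ((1 - u + t) / 2) ⟨by linarith [hu.2, ht.1], by linarith⟩
    have h2 := huA (1 - (1 - u + t) / 2) ⟨by linarith [hu.1, ht.2], by linarith⟩
    rw [hrev, sub_sub_cancel] at h2
    exact (hdisj i j hij).notMem_of_mem_left h1 h2
  rw [hrev] at huf
  set z := AffineMap.lineMap x y t
  set w := AffineMap.lineMap x y (1 - u)
  have d1 : dist x z = t * dist x y := by
    rw [dist_left_lineMap, Real.norm_of_nonneg ht.1]
  have d2 : dist z w = (1 - u - t) * dist x y := by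
    rw [dist_lineMap_lineMap, Real.dist_eq, abs_sub_comm, abs_of_nonneg (by linarith)]
  have d3 : dist w y = u * dist x y := by
    rw [dist_lineMap_right, sub_sub_cancel, Real.norm_of_nonneg hu.1]
  have b1 := hcl i x hi z (frontier_subset_closure htf)
  have b2 := hfr z (mem_iUnion.2 ⟨i, htf⟩) w (mem_iUnion.2 ⟨j, huf⟩)
  have b3 := hcl j w (frontier_subset_closure huf) y hj
  rw [d1] at b1
  rw [d2] at b2
  rw [d3] at b3
  calc dist (f x) (f y) ≤ dist (f x) (f z) + dist (f z) (f w) + dist (f w) (f y) :=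
        dist_triangle4 _ _ _ _
    _ ≤ C * (t * dist x y) + C * ((1 - u - t) * dist x y) + C * (u * dist x y) := by gcongr
    _ = C * dist x y := by ring

/-- The extension by zero of a map that is Lipschitz on a closed ball and vanishes on the boundary
sphere is Lipschitz. -/
theorem LipschitzOnWith.indicator_ball {F : Type*} [NormedAddCommGroup F] {K : ℝ≥0} {g : E → F}
    {R : ℝ} (hg : LipschitzOnWith K g (closedBall 0 R)) (h0 : ∀ x, ‖x‖ = R → g x = 0) :
    LipschitzWith K ((ball 0 R).indicator g) := by
  have hin : ∀ x ∈ closedBall (0 : E) R, (ball 0 R).indicator g x = g x := by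
    intro x hx
    by_cases h : x ∈ ball (0 : E) R
    · exact indicator_of_mem h g
    · rw [indicator_of_notMem h, h0 x (le_antisymm (by simpa using hx) (by simpa using h))]
  have key : ∀ x ∈ ball (0 : E) R, ∀ y ∉ ball (0 : E) R,
      dist ((ball 0 R).indicator g x) ((ball 0 R).indicator g y) ≤ K * dist x y := by
    intro x hx y hy
    obtain ⟨t, ht, htf, -⟩ := isOpen_ball.exists_lineMap_mem_frontier (subset_closure hx) hy
    have hz := frontier_ball_subset_sphere htf
    have hz0 : g (AffineMap.lineMap x y t) = 0 := h0 _ (by simpa using hz)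
    rw [indicator_of_mem hx, indicator_of_notMem hy, ← hz0]
    refine (hg.dist_le_mul x (ball_subset_closedBall hx) _ (sphere_subset_closedBall hz)).trans ?_
    gcongr
    rw [dist_left_lineMap, Real.norm_of_nonneg ht.1]
    exact mul_le_of_le_one_left dist_nonneg ht.2
  refine LipschitzWith.of_dist_le_mul fun x y => ?_
  by_cases hx : x ∈ ball (0 : E) R <;> by_cases hy : y ∈ ball (0 : E) R
  · rw [indicator_of_mem hx, indicator_of_mem hy]
    exact hg.dist_le_mul x (ball_subset_closedBall hx) y (ball_subset_closedBall hy)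
  · exact key x hx y hy
  · rw [dist_comm, dist_comm x]
    exact key y hy x hx
  · rw [indicator_of_notMem hx, indicator_of_notMem hy, dist_self]
    positivity

end Gluing

/-- A Lipschitz map of a finite-dimensional space to itself maps null sets to null sets. -/
theorem LipschitzWith.hausdorffMeasure_image_null {E : Type*} [NormedAddCommGroup E]
    [MeasurableSpace E] [BorelSpace E] {K : ℝ≥0} {f : E → E}
    (hf : LipschitzWith K f) {n : ℕ} {s : Set E} (hs : μH[n] s = 0) : μH[n] (f '' s) = 0 := by
  have h := (hf.lipschitzOnWith (s := s)).hausdorffMeasure_image_le (d := n) (by positivity)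
  rw [hs, mul_zero] at h
  exact le_antisymm h bot_le

/-! ### The determinant along a line through the identity. -/

section Polynomial
variable {E : Type*} [NormedAddCommGroup E] [NormedSpace ℝ E] [FiniteDimensional ℝ E]

/-- Along a line through the identity, the determinant is a polynomial of degree at most the
dimension. -/
theorem ContinuousLinearMap.exists_polynomial_det_one_add_smul (A : E →L[ℝ] E) :
    ∃ p : Polynomial ℝ, p.natDegree ≤ finrank ℝ E ∧
      ∀ t : ℝ, p.eval t = (1 + t • A : E →L[ℝ] E).det := by
  classical
  let b := finBasis ℝ E
  let M := LinearMap.toMatrix b b (A : E →ₗ[ℝ] E)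
  refine ⟨((Polynomial.X : Polynomial ℝ) • M.map Polynomial.C +
    (1 : Matrix (Fin (finrank ℝ E)) (Fin (finrank ℝ E)) ℝ).map Polynomial.C).det, ?_, fun t => ?_⟩
  · simpa using Polynomial.natDegree_det_X_add_C_le M (1 : Matrix (Fin (finrank ℝ E)) (Fin (finrank ℝ E)) ℝ)
  · have h : (1 + t • A : E →L[ℝ] E).det
        = (LinearMap.toMatrix b b ((1 + t • A : E →L[ℝ] E) : E →ₗ[ℝ] E)).det :=
      (LinearMap.det_toMatrix b _).symm
    rw [h, ← Polynomial.coe_evalRingHom, RingHom.map_det]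
    congr 1
    ext i j
    rcases eq_or_ne i j with rfl | hij
    · simp [M, add_comm, mul_comm t, LinearMap.toMatrix_apply]
    · simp [M, hij, mul_comm t, LinearMap.toMatrix_apply]

omit [FiniteDimensional ℝ E] in
theorem ContinuousLinearMap.exists_pos_forall_det_pos :
    ∃ δ > 0, ∀ A : E →L[ℝ] E, ‖A‖ < δ → 0 < (1 + A).det := by
  have hc : Continuous fun A : E →L[ℝ] E => (1 + A).det :=
    ContinuousLinearMap.continuous_det.comp (continuous_const.add continuous_id)
  have h1 : (0 : ℝ) < (1 + (0 : E →L[ℝ] E)).det := by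
    rw [add_zero]
    have : (1 : E →L[ℝ] E).det = 1 := LinearMap.det_id
    rw [this]; exact one_pos
  obtain ⟨δ, hδ, h⟩ := Metric.eventually_nhds_iff.1 (hc.continuousAt.eventually_const_lt h1)
  exact ⟨δ, hδ, fun A hA => h (by simpa using hA)⟩

/-- The value of `det (1 + t • A)` at `t = 1` is a linear combination of its values at finitely many
small `t`, with coefficients of sum `1` that do not depend on `A`. -/
theorem ContinuousLinearMap.exists_det_one_add_eq_sum {τ : ℝ} (hτ : 0 < τ) :
    ∃ (c v : ℕ → ℝ) (n : ℕ), (∀ i, 0 < v i ∧ v i ≤ τ) ∧ ∑ i ∈ Finset.range n, c i = 1 ∧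
      ∀ A : E →L[ℝ] E, (1 + A).det = ∑ i ∈ Finset.range n, c i * (1 + v i • A).det := by
  -- Any distinct nodes in `(0, τ]` would do; degree at most `finrank ℝ E` needs one more node than
  -- that.
  let v : ℕ → ℝ := fun i => τ / (i + 1)
  let s := Finset.range (finrank ℝ E + 1)
  have hv : Set.InjOn v s := by
    intro i _ j _ hij
    have : τ / ((i : ℝ) + 1) = τ / (j + 1) := hij
    field_simp at this
    exact_mod_cast (add_right_cancel this).symm
  have key : ∀ A : E →L[ℝ] E, (1 + A).det =
      ∑ i ∈ s, (Lagrange.basis s v i).eval 1 * (1 + v i • A).det := by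
    intro A
    obtain ⟨p, hp, hpe⟩ := A.exists_polynomial_det_one_add_smul
    have h := Lagrange.eq_interpolate hv (f := p) (by
      refine lt_of_le_of_lt p.degree_le_natDegree ?_
      simp only [s, Finset.card_range]
      exact_mod_cast Nat.lt_succ_of_le hp)
    have h1 := hpe 1
    rw [one_smul] at h1
    rw [← h1]
    conv_lhs => rw [h]
    rw [Lagrange.interpolate_apply, Polynomial.eval_finsetSum]
    refine Finset.sum_congr rfl fun i _ => ?_
    rw [Polynomial.eval_mul, Polynomial.eval_C, hpe, mul_comm]
  refine ⟨fun i => (Lagrange.basis s v i).eval 1, v, finrank ℝ E + 1, fun i => ⟨by positivity, ?_⟩,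
    ?_, key⟩
  · exact div_le_self hτ.le (by linarith [(Nat.cast_nonneg i : (0 : ℝ) ≤ i)])
  · rw [← Polynomial.eval_finsetSum, Lagrange.sum_basis hv ⟨0, by simp [s]⟩, Polynomial.eval_one]

end Polynomial

/-! ### The integral of the Jacobian. -/

section Volume
variable {E : Type*} [NormedAddCommGroup E] [NormedSpace ℝ E] [FiniteDimensional ℝ E]
  [MeasurableSpace E] [BorelSpace E]

omit [MeasurableSpace E] [BorelSpace E] in
theorem LipschitzWith.exists_norm_det_one_add_fderiv_le {K : ℝ≥0} {g : E → E}
    (hg : LipschitzWith K g) (t : ℝ) :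
    ∃ M, ∀ x, ‖(1 + t • fderiv ℝ g x).det‖ ≤ M := by
  have hc : Continuous fun A : E →L[ℝ] E => (1 + t • A).det :=
    ContinuousLinearMap.continuous_det.comp (by fun_prop)
  have : ProperSpace (E →L[ℝ] E) := FiniteDimensional.proper ℝ _
  obtain ⟨M, hM⟩ := (isCompact_closedBall (0 : E →L[ℝ] E) K).exists_bound_of_continuousOn
    hc.continuousOn
  exact ⟨M, fun x => hM _ (by simpa using norm_fderiv_le_of_lipschitz ℝ hg)⟩

theorem LipschitzWith.integrableOn_det_one_add_fderiv {K : ℝ≥0} {g : E → E}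
    (hg : LipschitzWith K g) (t : ℝ) {μ : Measure E} {s : Set E} (hs : μ s ≠ ⊤) :
    IntegrableOn (fun x => (1 + t • fderiv ℝ g x).det) s μ := by
  obtain ⟨M, hM⟩ := hg.exists_norm_det_one_add_fderiv_le t
  have hc : Continuous fun A : E →L[ℝ] E => (1 + t • A).det :=
    ContinuousLinearMap.continuous_det.comp (by fun_prop)
  exact Measure.integrableOn_of_bounded hs
    (hc.measurable.comp (measurable_fderiv ℝ g)).aestronglyMeasurable
    (Filter.Eventually.of_forall hM)

omit [MeasurableSpace E] [BorelSpace E] in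
/-- For small `t`, the map `x ↦ x + t • g x` is a bijection. -/
theorem LipschitzWith.bijective_add_smul {K : ℝ≥0} {g : E → E} (hg : LipschitzWith K g) {t : ℝ}
    (ht : 0 ≤ t) (htK : t * K < 1) : Function.Bijective fun x => x + t • g x := by
  have hap : ApproximatesLinearOn (fun x => x + t • g x)
      ((ContinuousLinearEquiv.refl ℝ E : E ≃L[ℝ] E) : E →L[ℝ] E) univ (t.toNNReal * K) := by
    intro x _ y _
    have h := hg.dist_le_mul x y
    rw [dist_eq_norm, dist_eq_norm] at h
    have e : x + t • g x - (y + t • g y) -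
        ((ContinuousLinearEquiv.refl ℝ E : E ≃L[ℝ] E) : E →L[ℝ] E) (x - y) = t • (g x - g y) := by
      simp [smul_sub]; abel
    rw [e, norm_smul, Real.norm_of_nonneg ht, NNReal.coe_mul, Real.coe_toNNReal t ht, mul_assoc]
    gcongr
  have hc : Subsingleton E ∨ t.toNNReal * K <
      ‖((ContinuousLinearEquiv.refl ℝ E : E ≃L[ℝ] E).symm : E →L[ℝ] E)‖₊⁻¹ := by
    rcases subsingleton_or_nontrivial E with h | h
    · exact Or.inl h
    · right
      have : ‖((ContinuousLinearEquiv.refl ℝ E : E ≃L[ℝ] E).symm : E →L[ℝ] E)‖₊ = 1 := by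
        ext; simp
      rw [this, inv_one, ← NNReal.coe_lt_coe, NNReal.coe_mul, Real.coe_toNNReal t ht]
      simpa using htK
  exact (hap.toHomeomorph _ hc).bijective

/-- Change of variables for a bijection of the ball; positivity of the determinant removes the
absolute value. -/
theorem LipschitzWith.setIntegral_det_one_add_smul_fderiv {K : ℝ≥0} {g : E → E}
    (hg : LipschitzWith K g) {R : ℝ} (h0 : ∀ x, R ≤ ‖x‖ → g x = 0) {t : ℝ}
    (ht : 0 ≤ t) (htK : t * K < 1) (hdet : ∀ x, 0 < (1 + t • fderiv ℝ g x).det) :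
    ∫ x in ball 0 R, (1 + t • fderiv ℝ g x).det ∂(μH[finrank ℝ E] : Measure E) =
      (μH[finrank ℝ E] : Measure E).real (ball 0 R) := by
  set μ : Measure E := μH[finrank ℝ E]
  let F : E → E := fun x => x + t • g x
  have hbij : Function.Bijective F := hg.bijective_add_smul ht htK
  -- `F` fixes every point outside the ball, so a bijection must preserve the ball.
  have himg : F '' ball 0 R = ball 0 R := by
    have hcompl : ∀ x, x ∉ ball (0 : E) R → F x = x := by
      intro x hx
      simp only [mem_ball_zero_iff, not_lt] at hx
      simp [F, h0 x hx]
    apply Subset.antisymm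
    · rintro _ ⟨x, hx, rfl⟩
      by_contra hFx
      rw [hbij.1 (hcompl _ hFx)] at hFx
      exact hFx hx
    · intro y hy
      obtain ⟨x, rfl⟩ := hbij.2 y
      refine ⟨x, ?_, rfl⟩
      by_contra hx
      rw [hcompl x hx] at hy
      exact hx hy
  -- By Rademacher the complement of `D` is null, and so is its image under the Lipschitz map `F`.
  let D := {x | DifferentiableAt ℝ g x}
  have hD : MeasurableSet D := measurableSet_of_differentiableAt ℝ g
  have hae : ∀ᵐ x ∂μ, x ∈ D := hg.ae_differentiableAt
  have hFlip : LipschitzWith (1 + ‖t‖₊ * K) F :=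
    LipschitzWith.id.add (((lipschitzWith_smul t).comp hg))
  have hnull : μ (F '' Dᶜ) = 0 := hFlip.hausdorffMeasure_image_null hae
  have hint := integral_image_eq_integral_abs_det_fderiv_smul μ
    (s := ball 0 R ∩ D) (f := F) (f' := fun x => 1 + t • fderiv ℝ g x)
    (measurableSet_ball.inter hD)
    (fun x hx => ((hasFDerivAt_id x).add (hx.2.hasFDerivAt.const_smul t)).hasFDerivWithinAt)
    hbij.1.injOn (fun _ => (1 : ℝ))
  have e1 : (ball (0 : E) R ∩ D : Set E) =ᵐ[μ] ball 0 R := by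
    filter_upwards [hae] with x hx
    exact propext ⟨fun h => h.1, fun h => ⟨h, hx⟩⟩
  have e2 : (F '' (ball 0 R ∩ D) : Set E) =ᵐ[μ] ball 0 R := by
    filter_upwards [measure_eq_zero_iff_ae_notMem.1 hnull] with x hx
    refine propext ⟨?_, ?_⟩
    · rintro ⟨y, hy, rfl⟩
      exact himg ▸ mem_image_of_mem F hy.1
    · intro hxR
      have hx' : x ∈ F '' ball 0 R := himg.symm ▸ hxR
      obtain ⟨y, hy, rfl⟩ := hx'
      exact ⟨y, ⟨hy, by_contra fun hyD => hx ⟨y, hyD, rfl⟩⟩, rfl⟩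
  rw [setIntegral_congr_set e1, setIntegral_congr_set e2] at hint
  simp only [smul_eq_mul, mul_one, abs_of_pos (hdet _), setIntegral_const] at hint
  exact hint.symm

/-- The total Jacobian of a Lipschitz map which is the identity outside a ball. -/
theorem LipschitzWith.setIntegral_det_one_add_fderiv {K : ℝ≥0} {g : E → E}
    (hg : LipschitzWith K g) {R : ℝ} (h0 : ∀ x, R ≤ ‖x‖ → g x = 0) :
    ∫ x in ball 0 R, (1 + fderiv ℝ g x).det ∂(μH[finrank ℝ E] : Measure E) =
      (μH[finrank ℝ E] : Measure E).real (ball 0 R) := by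
  obtain ⟨δ, hδ, hpos⟩ := ContinuousLinearMap.exists_pos_forall_det_pos (E := E)
  have hK : (0 : ℝ) < K + 1 := by positivity
  obtain ⟨c, v, n, hv, hc, hsum⟩ := ContinuousLinearMap.exists_det_one_add_eq_sum (E := E)
    -- The first bound makes `id + v i • g` bijective, the second makes its Jacobian positive; `K +
    -- 1` avoids dividing by zero.
    (τ := min (1 / (K + 1)) (δ / 2 / (K + 1))) (by positivity)
  simp only [fun x => hsum (fderiv ℝ g x)]
  rw [integral_finsetSum _ fun i _ =>
    (hg.integrableOn_det_one_add_fderiv (v i) measure_ball_lt_top.ne).const_mul _]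
  have hi : ∀ i, ∫ x in ball 0 R, (1 + v i • fderiv ℝ g x).det ∂(μH[finrank ℝ E] : Measure E) =
      (μH[finrank ℝ E] : Measure E).real (ball 0 R) := by
    intro i
    have hv1 : v i * (K + 1) ≤ 1 := (le_div_iff₀ hK).1 ((hv i).2.trans (min_le_left _ _))
    have hv2 : v i * (K + 1) ≤ δ / 2 := (le_div_iff₀ hK).1 ((hv i).2.trans (min_le_right _ _))
    refine hg.setIntegral_det_one_add_smul_fderiv h0 (hv i).1.le (by linarith [(hv i).1])
      fun x => hpos _ ?_
    rw [norm_smul, Real.norm_of_nonneg (hv i).1.le]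
    have := mul_le_mul_of_nonneg_left (norm_fderiv_le_of_lipschitz ℝ hg (x₀ := x)) (hv i).1.le
    linarith [(hv i).1]
  simp_rw [integral_const_mul, hi, ← Finset.sum_mul, hc, one_mul]

end Volume

/-! ### Lipschitz products and radial normalization. -/

theorem LipschitzOnWith.exists_smul_of_bounded {α F : Type*} [PseudoMetricSpace α]
    [NormedAddCommGroup F] [NormedSpace ℝ F] {s : Set α} {a : α → ℝ} {w : α → F} {Ka Kw : ℝ≥0}
    (ha : LipschitzOnWith Ka a s) (hw : LipschitzOnWith Kw w s) {M N : ℝ}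
    (hM : ∀ x ∈ s, ‖a x‖ ≤ M) (hN : ∀ x ∈ s, ‖w x‖ ≤ N) :
    ∃ K, LipschitzOnWith K (fun x => a x • w x) s := by
  refine ⟨(M * Kw + Ka * N).toNNReal, LipschitzOnWith.of_dist_le_mul fun x hx y hy => ?_⟩
  have h1 := ha.dist_le_mul x hx y hy
  have h2 := hw.dist_le_mul x hx y hy
  rw [dist_eq_norm] at h1 h2
  have e : a x • w x - a y • w y = a x • (w x - w y) + (a x - a y) • w y := by
    rw [smul_sub, sub_smul]; abel
  have hM0 : 0 ≤ M := (norm_nonneg _).trans (hM x hx)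
  calc dist (a x • w x) (a y • w y) ≤ ‖a x‖ * ‖w x - w y‖ + ‖a x - a y‖ * ‖w y‖ := by
        rw [dist_eq_norm, e]
        exact (norm_add_le _ _).trans_eq (by rw [norm_smul, norm_smul])
    _ ≤ M * (Kw * dist x y) + Ka * dist x y * N := by
        gcongr
        · exact hM x hx
        · exact hN y hy
    _ = (M * Kw + Ka * N) * dist x y := by ring
    _ ≤ _ := by gcongr; exact Real.le_coe_toNNReal _

section Normalize
variable {E : Type*} [NormedAddCommGroup E] [NormedSpace ℝ E]

theorem lipschitzOnWith_inv_norm_smul {m : ℝ} (hm : 0 < m) :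
    LipschitzOnWith (2 / m).toNNReal (fun y : E => ‖y‖⁻¹ • y) {y | m ≤ ‖y‖} := by
  refine LipschitzOnWith.of_dist_le_mul fun y hy z hz => ?_
  simp only [mem_ofPred_eq] at hy hz
  have hy0 : 0 < ‖y‖ := hm.trans_le hy
  have hz0 : 0 < ‖z‖ := hm.trans_le hz
  have e : ‖y‖⁻¹ • y - ‖z‖⁻¹ • z = ‖y‖⁻¹ • (y - z) + (‖y‖⁻¹ - ‖z‖⁻¹) • z := by
    rw [smul_sub, sub_smul]; abel
  have h2 : ‖(‖y‖⁻¹ - ‖z‖⁻¹) • z‖ ≤ ‖y‖⁻¹ * ‖y - z‖ := by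
    have e2 : ‖y‖⁻¹ - ‖z‖⁻¹ = ‖y‖⁻¹ * (‖z‖ - ‖y‖) * ‖z‖⁻¹ := by field_simp
    rw [norm_smul, e2, norm_mul, norm_mul, norm_inv, norm_inv, norm_norm, norm_norm,
      inv_mul_cancel_right₀ hz0.ne', ← norm_sub_rev z y]
    gcongr
    exact abs_norm_sub_norm_le z y
  rw [dist_eq_norm, e, dist_eq_norm, Real.coe_toNNReal _ (by positivity)]
  calc _ ≤ ‖y‖⁻¹ * ‖y - z‖ + ‖y‖⁻¹ * ‖y - z‖ :=
        (norm_add_le _ _).trans (add_le_add (by rw [norm_smul, norm_inv, norm_norm]) h2)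
    _ = 2 / ‖y‖ * ‖y - z‖ := by ring
    _ ≤ 2 / m * ‖y - z‖ := by gcongr

theorem norm_inv_norm_smul_le (y : E) : ‖‖y‖⁻¹ • y‖ ≤ 1 := by
  rw [norm_smul, norm_inv, norm_norm]
  exact inv_mul_le_one

theorem LipschitzOnWith.exists_inv_norm_smul {α : Type*} [PseudoMetricSpace α] {s : Set α}
    {F : α → E} {K : ℝ≥0} (hF : LipschitzOnWith K F s) {m : ℝ} (hm : 0 < m)
    (hle : ∀ x ∈ s, m ≤ ‖F x‖) : ∃ K', LipschitzOnWith K' (fun x => ‖F x‖⁻¹ • F x) s :=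
  ⟨_, (lipschitzOnWith_inv_norm_smul hm).comp hF hle⟩

end Normalize

/-! ### Existence of zeros. -/

section Degree
variable {E : Type*} [NormedAddCommGroup E] [InnerProductSpace ℝ E] [FiniteDimensional ℝ E]

/-- A map whose norm is locally constant and nonzero has singular derivative. -/
theorem HasFDerivAt.det_eq_zero_of_norm_eventuallyEq {F : E → E} {F' : E →L[ℝ] E} {x : E} {R : ℝ}
    (hF : HasFDerivAt F F' x) (hR : 0 < R) (h : ∀ᶠ y in 𝓝 x, ‖F y‖ = R) : F'.det = 0 := by
  by_contra hdet
  have hsurj : Function.Surjective F' :=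
    ((Module.End.isUnit_iff (F' : E →ₗ[ℝ] E)).1
      ((LinearMap.isUnit_iff_isUnit_det _).2 (isUnit_iff_ne_zero.2 hdet))).2
  have h1 := hF.norm_sq
  have h2 : HasFDerivAt (fun y => ‖F y‖ ^ 2) (0 : E →L[ℝ] ℝ) x :=
    (hasFDerivAt_const (R ^ 2) x).congr_of_eventuallyEq (h.mono fun y hy => by simp [hy])
  obtain ⟨v, hv⟩ := hsurj (F x)
  have h3 := congrArg (fun L : E →L[ℝ] ℝ => L v) (h1.unique h2)
  simp [hv, h.self_of_nhds, hR.ne'] at h3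

variable [MeasurableSpace E] [BorelSpace E]

/-- A Lipschitz map that is the identity outside a ball around `0` has a zero. -/
theorem LipschitzWith.exists_add_eq_zero {K : ℝ≥0} {g : E → E} (hg : LipschitzWith K g) {R : ℝ}
    (hR : 0 < R) (h0 : ∀ x, R ≤ ‖x‖ → g x = 0) : ∃ x, x + g x = 0 := by
  by_contra! hne
  have hF : LipschitzWith (1 + K) fun x => x + g x := LipschitzWith.id.add hg
  obtain ⟨m, hm, hmle⟩ := (isCompact_closedBall (0 : E) R).exists_forall_le'
    hF.continuous.norm.continuousOn (a := 0) fun x _ => norm_pos_iff.2 (hne x)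
  obtain ⟨K₁, hK₁⟩ := hF.lipschitzOnWith.exists_inv_norm_smul hm hmle
  have hr : LipschitzOnWith (‖R‖₊ * K₁ + 1)
      (fun x => R • ‖x + g x‖⁻¹ • (x + g x) - x) (closedBall 0 R) :=
    ((lipschitzWith_smul R).comp_lipschitzOnWith hK₁).sub LipschitzWith.id.lipschitzOnWith
  have hg' := hr.indicator_ball fun x hx => by
    rw [h0 x hx.ge, add_zero, hx, smul_inv_smul₀ hR.ne', sub_self]
  -- In the ball, `x + G x` is the radial projection of `x + g x` to the sphere of radius `R`.
  set G := (ball (0 : E) R).indicator fun x => R • ‖x + g x‖⁻¹ • (x + g x) - x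
  have hvol := hg'.setIntegral_det_one_add_fderiv (R := R) fun x hx =>
    indicator_of_notMem (by simpa using hx) _
  have hnorm : ∀ x ∈ ball (0 : E) R, ‖x + G x‖ = R := by
    intro x hx
    rw [show G x = _ from indicator_of_mem hx _, add_sub_cancel, norm_smul, norm_smul, norm_inv, norm_norm,
      inv_mul_cancel₀ (norm_ne_zero_iff.2 (hne x)), mul_one, Real.norm_of_nonneg hR.le]
  have hzero : ∫ x in ball 0 R, (1 + fderiv ℝ G x).det ∂(μH[finrank ℝ E] : Measure E) = 0 := by
    rw [setIntegral_congr_ae (g := fun _ => (0 : ℝ)) measurableSet_ball, integral_zero]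
    filter_upwards [hg'.ae_differentiableAt] with x hx hxR
    exact ((hasFDerivAt_id x).add hx.hasFDerivAt).det_eq_zero_of_norm_eventuallyEq hR
      (Filter.eventually_of_mem (isOpen_ball.mem_nhds hxR) hnorm)
  rw [hzero] at hvol
  exact (ENNReal.toReal_pos (measure_ball_pos _ _ hR).ne' measure_ball_lt_top.ne).ne hvol

/-- A Lipschitz map on a closed ball around `0` that is uniformly closer to the identity than the
radius has a zero. -/
theorem LipschitzOnWith.exists_eq_zero_of_norm_sub_le {K : ℝ≥0} {h : E → E} {R δ : ℝ}
    (hh : LipschitzOnWith K h (closedBall 0 R)) (hδ0 : 0 ≤ δ) (hδ : δ < R)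
    (hle : ∀ x ∈ closedBall (0 : E) R, ‖h x - x‖ ≤ δ) : ∃ x ∈ closedBall (0 : E) R, h x = 0 := by
  have hd : 0 < R - δ := sub_pos.2 hδ
  -- This cutoff is `1` for `‖x‖ ≤ δ` and `0` on the sphere of radius `R`. A zero of `x + a x • (h x
  -- - x)` has norm at most `δ`, hence is a zero of `h`.
  let a : E → ℝ := fun x => min 1 ((R - δ)⁻¹ * (R - ‖x‖))
  have ha : LipschitzWith (max 0 (‖(R - δ)⁻¹‖₊ * (0 + 1))) a :=
    (LipschitzWith.const (1 : ℝ)).min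
      ((lipschitzWith_smul ((R - δ)⁻¹)).comp ((LipschitzWith.const R).sub lipschitzWith_one_norm))
  have ha01 : ∀ x ∈ closedBall (0 : E) R, 0 ≤ a x ∧ a x ≤ 1 := fun x hx =>
    ⟨le_min zero_le_one (mul_nonneg (inv_nonneg.2 hd.le) (sub_nonneg.2 (by simpa using hx))),
      min_le_left _ _⟩
  obtain ⟨K', hK'⟩ := ha.lipschitzOnWith.exists_smul_of_bounded
    (hh.sub LipschitzWith.id.lipschitzOnWith) (M := 1)
    (fun x hx => by rw [Real.norm_of_nonneg (ha01 x hx).1]; exact (ha01 x hx).2) hle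
  obtain ⟨x, hx⟩ := (hK'.indicator_ball fun x hx => by simp [a, hx]).exists_add_eq_zero
    (hδ0.trans_lt hδ) fun x hx => indicator_of_notMem (by simpa using hx) _
  have hxR : x ∈ ball (0 : E) R := by
    by_contra hxR
    rw [indicator_of_notMem hxR, add_zero] at hx
    exact hxR (by simpa [hx] using hδ0.trans_lt hδ)
  have hxc := ball_subset_closedBall hxR
  refine ⟨x, hxc, ?_⟩
  rw [indicator_of_mem hxR] at hx
  simp only [id] at hx
  have hxδ : ‖x‖ ≤ δ := by
    rw [eq_neg_of_add_eq_zero_left hx, norm_neg, norm_smul, Real.norm_of_nonneg (ha01 x hxc).1]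
    exact (mul_le_of_le_one_left (norm_nonneg _) (ha01 x hxc).2).trans (hle x hxc)
  have ha1 : a x = 1 := by
    refine min_eq_left ?_
    rw [inv_mul_eq_div, le_div_iff₀ hd]
    linarith
  simpa [ha1] using hx

/-! ### Invariance of domain. -/

omit [FiniteDimensional ℝ E] [MeasurableSpace E] [BorelSpace E] in
/-- A set missing a point `c` is pushed off the open `ε`-ball around `c` by a Lipschitz map. -/
theorem LipschitzOnWith.exists_push_off_ball {α : Type*} [PseudoMetricSpace α] {s : Set α}
    {f : α → E} {K : ℝ≥0} (hf : LipschitzOnWith K f s) {c : E} {m ε : ℝ} (hm : 0 < m) (hε : 0 < ε)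
    (hle : ∀ x ∈ s, m ≤ ‖f x - c‖) :
    ∃ (φ : α → E) (K' : ℝ≥0), LipschitzOnWith K' φ s ∧ (∀ x ∈ s, ‖φ x - f x‖ ≤ ε) ∧
      ∀ x ∈ s, (ε ≤ ‖f x - c‖ ∧ φ x = f x) ∨ φ x ∈ sphere c ε := by
  have hfc : LipschitzOnWith (K + 0) (fun x => f x - c) s :=
    hf.sub (LipschitzWith.const c).lipschitzOnWith
  -- The radial distance still missing to the sphere around `c`.
  let a : α → ℝ := fun x => max (ε - ‖f x - c‖) 0
  have ha : LipschitzOnWith (max (0 + 1 * (K + 0)) 0) a s := by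
    rw [lipschitzOnWith_iff_restrict] at hfc ⊢
    exact ((LipschitzWith.const ε).sub (lipschitzWith_one_norm.comp hfc)).max
      (LipschitzWith.const (0 : ℝ))
  have ha0 : ∀ x, 0 ≤ a x := fun x => le_max_right _ _
  have haε : ∀ x, a x ≤ ε := fun x => max_le (by linarith [norm_nonneg (f x - c)]) hε.le
  obtain ⟨K₁, hK₁⟩ := hfc.exists_inv_norm_smul hm hle
  obtain ⟨K₂, hK₂⟩ := ha.exists_smul_of_bounded hK₁ (M := ε) (N := 1)
    (fun x _ => by rw [Real.norm_of_nonneg (ha0 x)]; exact haε x)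
    (fun x _ => norm_inv_norm_smul_le _)
  refine ⟨fun x => f x + a x • ‖f x - c‖⁻¹ • (f x - c), _, hf.add hK₂, fun x _ => ?_,
    fun x hx => ?_⟩
  · rw [add_sub_cancel_left, norm_smul, Real.norm_of_nonneg (ha0 x)]
    exact (mul_le_of_le_one_right (ha0 x) (norm_inv_norm_smul_le _)).trans (haε x)
  · rcases le_or_gt ε ‖f x - c‖ with h | h
    · left
      have : a x = 0 := max_eq_right (by linarith)
      simp [this, h]
    · right
      have hax : a x = ε - ‖f x - c‖ := max_eq_left (by linarith)
      have hpos : 0 < ‖f x - c‖ := hm.trans_le (hle x hx)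
      have e : f x + a x • ‖f x - c‖⁻¹ • (f x - c) - c = (ε * ‖f x - c‖⁻¹) • (f x - c) := by
        have e1 : ε * ‖f x - c‖⁻¹ = 1 + a x * ‖f x - c‖⁻¹ := by
          rw [hax]; field_simp; ring
        rw [e1, add_smul, one_smul, mul_smul]; abel
      rw [mem_sphere_iff_norm, e, norm_smul, norm_mul, norm_inv, norm_norm,
        inv_mul_cancel_right₀ hpos.ne', Real.norm_of_nonneg hε.le]

/-- Extend the inverse to a Lipschitz `G`. If the image misses some `c` near `0`, push `f` off a
small ball around `c` to get `φ`. Then `G ∘ φ` is close to the identity, so it takes every small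
value `v`. Yet `v` can be chosen outside the null set `G '' sphere c ε`, while `φ = f` would force
`f v` to be at distance at least `ε` from `c`. -/
theorem image_closedBall_zero_mem_nhds_of_bilipschitz {f : E → E} {C : ℝ≥0} {R : ℝ} (hR : 0 < R)
    (hf0 : f 0 = 0) (hf : LipschitzOnWith C f (closedBall 0 R))
    (hf' : ∀ x ∈ closedBall (0 : E) R, ∀ y ∈ closedBall (0 : E) R,
      dist x y ≤ C * dist (f x) (f y)) :
    f '' closedBall 0 R ∈ 𝓝 (0 : E) := by
  have h0R : (0 : E) ∈ closedBall (0 : E) R := mem_closedBall_self hR.le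
  have hinj : InjOn f (closedBall 0 R) := fun x hx y hy hxy => by
    have := hf' x hx y hy
    rw [hxy, dist_self, mul_zero] at this
    exact dist_le_zero.1 this
  have hinv : LipschitzOnWith C (Function.invFunOn f (closedBall 0 R)) (f '' closedBall 0 R) := by
    refine LipschitzOnWith.of_dist_le_mul ?_
    rintro _ ⟨x, hx, rfl⟩ _ ⟨y, hy, rfl⟩
    rw [hinj.leftInvOn_invFunOn hx, hinj.leftInvOn_invFunOn hy]
    exact hf' x hx y hy
  obtain ⟨G, hG, hGeq⟩ := hinv.extend_finite_dimension
  set K := lipschitzExtensionConstant E * C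
  have hGf : ∀ x ∈ closedBall (0 : E) R, G (f x) = x := fun x hx =>
    (hGeq (mem_image_of_mem f hx)).symm.trans (hinj.leftInvOn_invFunOn hx)
  by_contra hnhds
  rw [Metric.mem_nhds_iff] at hnhds
  push Not at hnhds
  have hK1 : (0 : ℝ) < K + 1 := by positivity
  set ε : ℝ := R / 4 / (K + 1)
  have hε : 0 < ε := by positivity
  have hKε : K * ε ≤ R / 4 := by
    have : (K + 1) * ε = R / 4 := by simp only [ε]; field_simp
    linarith
  obtain ⟨c, hcε, hc⟩ := not_subset.1 (hnhds ε hε)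
  rw [mem_ball_zero_iff] at hcε
  obtain ⟨m, hm, hmle⟩ := (isCompact_closedBall (0 : E) R).exists_forall_le'
    (hf.continuousOn.sub continuousOn_const).norm (a := 0) fun x hx =>
      norm_pos_iff.2 (sub_ne_zero.2 fun h : f x = c => hc ⟨x, hx, h⟩)
  obtain ⟨φ, Kφ, hφ, hφle, hφc⟩ := hf.exists_push_off_ball hm hε hmle
  -- The first bound puts `f v` within less than `ε` of `c`; the second keeps the total
  -- displacement, at most `K * ε + ‖v‖`, below `R / 2`.
  set η : ℝ := min ((ε - ‖c‖) / (C + 1)) (R / 4)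
  have hC1 : (0 : ℝ) < C + 1 := by positivity
  have hη : 0 < η := lt_min (div_pos (by linarith) hC1) (by linarith)
  have hnull : (μH[finrank ℝ E] : Measure E) (G '' sphere c ε) = 0 :=
    hG.hausdorffMeasure_image_null (addHaar_sphere_of_ne_zero _ c hε.ne')
  obtain ⟨v, hvη, hv⟩ : ∃ v ∈ ball (0 : E) η, v ∉ G '' sphere c ε := by
    by_contra! hsub
    exact (measure_ball_pos (μH[finrank ℝ E] : Measure E) 0 hη).ne' (measure_mono_null hsub hnull)
  rw [mem_ball_zero_iff] at hvη
  have hv1 : ‖v‖ * (C + 1) < ε - ‖c‖ := (lt_div_iff₀ hC1).1 (hvη.trans_le (min_le_left _ _))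
  have hv2 : ‖v‖ < R / 4 := hvη.trans_le (min_le_right _ _)
  have hH : LipschitzOnWith (K * Kφ + 0) (fun x => G (φ x) - v) (closedBall 0 R) :=
    (hG.comp_lipschitzOnWith hφ).sub (LipschitzWith.const v).lipschitzOnWith
  obtain ⟨x, hx, hx0⟩ := hH.exists_eq_zero_of_norm_sub_le (δ := R / 2) (by linarith) (by linarith)
    fun x hx => by
      have h1 := hG.dist_le_mul (φ x) (f x)
      rw [dist_eq_norm, dist_eq_norm, hGf x hx] at h1
      have h2 := mul_le_mul_of_nonneg_left (hφle x hx) K.coe_nonneg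
      rw [sub_right_comm]
      linarith [norm_sub_le (G (φ x) - x) v]
  rw [sub_eq_zero] at hx0
  rcases hφc x hx with ⟨hge, heq⟩ | hsph
  · rw [heq, hGf x hx] at hx0
    subst hx0
    have h1 := hf.dist_le_mul x hx 0 h0R
    rw [hf0, dist_zero_right, dist_zero_right] at h1
    linarith [norm_sub_le (f x) c, norm_nonneg x]
  · exact hv ⟨_, hsph, hx0⟩

/-- Invariance of domain for bilipschitz maps. -/
theorem IsOpen.image_of_bilipschitzOn {f : E → E} {C : ℝ≥0} {U : Set E} (hU : IsOpen U)
    (hf : LipschitzOnWith C f U)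
    (hf' : ∀ x ∈ U, ∀ y ∈ U, dist x y ≤ C * dist (f x) (f y)) : IsOpen (f '' U) := by
  rw [isOpen_iff_mem_nhds]
  rintro _ ⟨x, hx, rfl⟩
  obtain ⟨R, hR, hRU⟩ := Metric.nhds_basis_closedBall.mem_iff.1 (hU.mem_nhds hx)
  have hmem : ∀ z ∈ closedBall (0 : E) R, x + z ∈ U := fun z hz =>
    hRU (by simpa [dist_eq_norm] using hz)
  have key := image_closedBall_zero_mem_nhds_of_bilipschitz (f := fun z => f (x + z) - f x)
    (C := C) hR (by simp)
    (LipschitzOnWith.of_dist_le_mul fun z hz w hw => by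
      simpa using hf.dist_le_mul _ (hmem z hz) _ (hmem w hw))
    (fun z hz w hw => by simpa using hf' _ (hmem z hz) _ (hmem w hw))
  have hcont : Filter.Tendsto (fun y => y - f x) (𝓝 (f x)) (𝓝 0) := by
    simpa using (continuous_sub_right (f x)).tendsto (f x)
  filter_upwards [hcont key] with y hy
  obtain ⟨z, hz, hzy⟩ := hy
  exact ⟨x + z, hmem z hz, sub_left_injective hzy⟩

end Degree

/-! ### The main theorem. -/

theorem mainTheorem6 (d : ℕ) {I : Type*} (A : I → Set (EuclideanSpace ℝ (Fin d)))
    (hA_open : ∀ i, IsOpen (A i))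
    (hA_disj : ∀ i j, i ≠ j → Disjoint (A i) (A j))
    (hA_cover : ⋃ i, closure (A i) = Set.univ)
    (C : ℝ) (hC : 1 ≤ C)
    (f : EuclideanSpace ℝ (Fin d) → EuclideanSpace ℝ (Fin d))
    (hf_boundary : IsBilipschitz C ((⋃ i, frontier (A i)).domRestrict f))
    (hf_closure : ∀ i, IsBilipschitz C ((closure (A i)).domRestrict f))
    (hf_image : ∀ i, f '' closure (A i) = closure (A i)) :
    IsBilipschitz C f := by
  have hC0 : 0 ≤ C := zero_le_one.trans hC
  rw [isBilipschitz_domRestrict_iff hC0] at hf_boundary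
  simp only [isBilipschitz_domRestrict_iff hC0] at hf_closure
  rw [isBilipschitz_iff hC0]
  have hlip := dist_le_of_forall_closure_of_frontier hA_open hA_disj hA_cover hf_boundary.1
    fun i => (hf_closure i).1
  refine ⟨hlip, ?_⟩
  lift C to ℝ≥0 using hC0
  have hfl : LipschitzWith C f := LipschitzWith.of_dist_le_mul hlip
  have hclosure : ∀ i, closure (f '' A i) = f '' closure (A i) := fun i =>
    (closure_minimal (image_mono subset_closure) ((hf_image i).symm ▸ isClosed_closure)).antisymm
      (image_closure_subset_closure_image hfl.continuous)
  have hopen : ∀ i, IsOpen (f '' A i) := fun i => (hA_open i).image_of_bilipschitzOn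
    hfl.lipschitzOnWith fun x hx y hy =>
      (hf_closure i).2 x (subset_closure hx) y (subset_closure hy)
  -- `f '' A i` lies in `closure (A i)`, so it misses `A j`; being open, it also misses the closure
  -- of `A j`.
  have hdisj' : ∀ i j, i ≠ j → Disjoint (f '' A i) (closure (A j)) := by
    intro i j hij
    have h1 : Disjoint (closure (A i)) (A j) := (hA_disj i j hij).closure_left (hA_open j)
    exact (h1.mono_left ((image_mono subset_closure).trans (hf_image i).subset)).closure_right
      (hopen i)
  have hinjcl : ∀ i, InjOn f (closure (A i)) := fun i x hx y hy hxy => by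
    have := (hf_closure i).2 x hx y hy
    rw [hxy, dist_self, mul_zero] at this
    exact dist_le_zero.1 this
  have hmem : ∀ i j x y, x ∈ A i → y ∈ closure (A j) → f x = f y → x = y := by
    intro i j x y hx hy hxy
    rcases eq_or_ne i j with rfl | hij
    · exact hinjcl i (subset_closure hx) hy hxy
    · exact ((hdisj' i j hij).notMem_of_mem_left (mem_image_of_mem f hx)
        (hf_image j ▸ hxy ▸ mem_image_of_mem f hy)).elim
  have hinj : Function.Injective f := by
    intro x y hxy
    obtain ⟨i, hi⟩ := mem_iUnion.1 (hA_cover ▸ mem_univ x)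
    obtain ⟨j, hj⟩ := mem_iUnion.1 (hA_cover ▸ mem_univ y)
    by_cases hx : x ∈ A i
    · exact hmem i j x y hx hj hxy
    by_cases hy : y ∈ A j
    · exact (hmem j i y x hy hi hxy.symm).symm
    have hfr : ∀ {k z}, z ∈ closure (A k) → z ∉ A k → z ∈ ⋃ i, frontier (A i) := fun {k z} h h' =>
      mem_iUnion.2 ⟨k, (hA_open k).frontier_eq ▸ ⟨h, h'⟩⟩
    have := hf_boundary.2 x (hfr hi hx) y (hfr hj hy)
    rw [hxy, dist_self, mul_zero] at this
    exact dist_le_zero.1 this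
  have hcover' : ⋃ i, closure (f '' A i) = univ := by
    simp only [hclosure, hf_image, hA_cover]
  have hsurj : Function.Surjective f := by
    intro y
    obtain ⟨i, hi⟩ := mem_iUnion.1 (hA_cover ▸ mem_univ y)
    rw [← hf_image i] at hi
    obtain ⟨x, -, hx⟩ := hi
    exact ⟨x, hx⟩
  let e := Equiv.ofBijective f ⟨hinj, hsurj⟩
  have hes : ∀ x, e.symm (f x) = x := e.symm_apply_apply
  have hfrontier : ∀ i, frontier (f '' A i) = f '' frontier (A i) := fun i => by
    rw [(hopen i).frontier_eq, (hA_open i).frontier_eq, hclosure, image_sdiff hinj]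
  have main := dist_le_of_forall_closure_of_frontier (f := e.symm) (C := C) hopen
    (fun i j hij => (hdisj' i j hij).mono_right
      ((image_mono subset_closure).trans (hf_image j).subset)) hcover'
    (by
      simp only [hfrontier, ← image_iUnion]
      rintro _ ⟨x, hx, rfl⟩ _ ⟨y, hy, rfl⟩
      rw [hes, hes]
      exact hf_boundary.2 x hx y hy)
    (by
      intro i
      rw [hclosure]
      rintro _ ⟨x, hx, rfl⟩ _ ⟨y, hy, rfl⟩
      rw [hes, hes]
      exact (hf_closure i).2 x hx y hy)
  intro x y
  simpa only [hes] using main (f x) (f y)
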